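/- **Setting (classical).** A structural causal model $\mathcal M=\langle \mathbf U,\mathbf V,\mathbf F\rangle$ consists of finite-valued endogenous variables $V_1,\dots,V_n$, finite-valued exogenous variables $U_1,\dots,U_n$, parent sets $Pa_i\subseteq\mathbf V$ and functions $f_i$ with $v_i=f_i(pa_i,u_i)$, such that the directed graph with an arrow $V_j\to V_i$ whenever $V_j\in Pa_i$ is acyclic. For given $\mathbf u$ let $\mathbf V(\mathbf u)$ be the unique solution of these equations. A probabilistic structural causal model (PSM) is $\mathcal M$ together with a probability distribution $P(\mathbf u)$; put $P(\mathbf v)=\sum_{\mathbf u:\mathbf V(\mathbf u)=\mathbf v}P(\mathbf u)$. The exogenous variables are assumed independent: $P(\mathbf u)=\prod_{i=1}^n P(u_i)$. **Setting (quantum).** All Hilbert spaces are non-zero and finite-dimensional, with fixed computational bases. A quantum node $A$ has an incoming space $\mathcal H_{A^{\rm in}}$ and an outgoing space $\mathcal H_{A^{\rm out}}$. An operation $\mathcal T:\mathcal L(\mathcal H_{A^{\rm in}})\to\mathcal L(\mathcal H_{A^{\rm out}})$ at the node is represented by $\tau=\sum_{x,y}\mathcal T(|x\rangle\langle y|)^T\otimes|y\rangle\langle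 x|$, and a map $\mathcal E$ between nodes by $\rho^{\mathcal E}=\sum_{x,y}\mathcal E(|x\rangle\langle y|)\otimes|x\rangle\langle y|$; write $\rho^W$ for $\mathcal E=W\cdot W^\dagger$. A quantum structural causal model (QSM) $\mathcal Q$ consists of * endogenous nodes $A_1,\dots,A_n$, exogenous nodes $\Lambda_1,\dots,\Lambda_n$ and a sink with incoming space $\mathcal H_{S^{\rm in}}$; * a unitary $W:\bigotimes_i\mathcal H_{A_i^{\rm out}}\otimes\bigotimes_i\mathcal H_{\Lambda_i^{\rm out}}\to\bigotimes_i\mathcal H_{A_i^{\rm in}}\otimes\mathcal H_{S^{\rm in}}$ whose operator $\rho^W$ is normalised (total probability $1$ for all channels at the $A_i$ and all states prepared at the $\Lambda_i$) and such that $\Lambda_j$ does not influence $A_i$ for $j\ne i$: the partial trace of $\rho^W$ over all incoming spaces except $\mathcal H_{A_i^{\rm in}}$ equals $\rho^{\mathcal E}\otimes\mathbb I_{\Lambda_j^{\rm out}}$ for some channel $\mathcal E$ from the remaining outgoing spaces to $A_i^{\rm in}$; * for every $i$ a discard-and-prepare instrument at $\Lambda_i$, which discards its input and with probability $P(\lambda_i)$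 prepares a density operator $\rho^{\lambda_i}$; put $\widetilde\tau^{\lambda_i}_{\Lambda_i}=P(\lambda_i)(\rho^{\lambda_i})^T\otimes\mathbb I_{\Lambda_i^{\rm in}}/\dim\mathcal H_{\Lambda_i^{\rm in}}$. **Theorem.** Every PSM $\langle\mathcal M,P(\mathbf u)\rangle$ with independent exogenous variables extends to a QSM $\mathcal Q$ with endogenous nodes $V''_1,\dots,V''_n$, exogenous nodes $\Lambda''_1,\dots,\Lambda''_n$ and sink $S''$, as follows. 1. (Nodes.) Let $N_i=\lceil\log_2|V_i|\rceil$, and let $c_i$ be the number of children of $V_i$, or $1$ if $V_i$ has no child. Then $\mathcal H_{V''^{\rm in}_i}=\mathcal H_{V''^{\rm out}_i}=\big((\mathbb C^2)^{\otimes N_i}\big)^{\otimes c_i}$, with one factor $(\mathbb C^2)^{\otimes N_i}$ ("copy") for every child of $V_i$. The values $v_i$ are encoded injectively as bit strings, giving basis vectors $|v_i\rangle\in(\mathbb C^2)^{\otimes N_i}$. The instrument at $\Lambda''_i$ has the values $u_i$ of $U_i$ as its outcomes, with probabilities $P(u_i)$. 2. (Probabilities.) Let $\tau^{v_i}_{V''_i}=|w\rangle\langle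 w|\otimes|w\rangle\langle w|$ with $|w\rangle=|v_i\rangle^{\otimes c_i}$ represent the outcome $v_i$ of the projective measurement of $V''_i$ in the copied computational basis. Then for all $\mathbf v$ $$P(\mathbf v)=\sum_{\mathbf u}\prod_{i=1}^n\delta_{v_i,f_i(pa_i,u_i)}P(u_i)=\sum_{\mathbf u}\operatorname{tr}\Big[\rho^W_{\mathbf V''S''|\mathbf V''\mathbf\Lambda''}\big(\tau^{v_1}_{V''_1}\otimes\cdots\otimes\tau^{v_n}_{V''_n}\big)\otimes\big(\widetilde\tau^{u_1}_{\Lambda''_1}\otimes\cdots\otimes\widetilde\tau^{u_n}_{\Lambda''_n}\big)\Big],$$ the trace being over all spaces, with $\rho^W$ and the $\tau$'s padded by identities; moreover, the two sums agree term by term. 3. (Factorisation.) Let $Pa''_i$ be the tensor product of those copies in the outgoing spaces of the parents of $V_i$ that belong to the child $V_i$. There are spaces $\mathcal H_{S''_i}$ and unitaries $W_i:\mathcal H_{Pa''_i}\otimes\mathcal H_{\Lambda''^{\rm out}_i}\to\mathcal H_{V''^{\rm in}_i}\otimes\mathcal H_{S''_i}$ such that $$\rho^W_{\mathbf V''S''|\mathbf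 V''\mathbf\Lambda''}=\prod_{i=1}^n\rho^{W_i}_{V''_iS''_i|Pa''_i\Lambda''_i},$$ where the factors act on pairwise disjoint tensor factors. Here the sink $S''$ consists of the $S''_i$ and of a copy of the outgoing spaces of the nodes without children, and the product is understood to be padded with the identity channel that carries those outgoing spaces to the sink. -/

import Mathlib

open scoped ComplexOrder Kronecker

universe u v

noncomputable section

/-! ## Classical structural causal models -/

/-- A (classical) structural causal model with `n` endogenous variables `V i`, `n` exogenous
variables `U i` (all finite-valued), parent sets `pa i`, and structural functions
`v i = f i (pa i) (u i)`, whose causal graph (`j ⟶ i` iff `j ∈ pa i`) is acyclic. -/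
structure CSM (n : ℕ) where
  V : Fin n → Type v
  U : Fin n → Type u
  [fintypeV : ∀ i, Fintype (V i)]
  [fintypeU : ∀ i, Fintype (U i)]
  pa : Fin n → Finset (Fin n)
  f : ∀ i, (∀ j : {j // j ∈ pa i}, V j.1) → U i → V i
  acyclic : ∀ i, ¬ Relation.TransGen (fun j k => j ∈ pa k) i i

attribute [instance] CSM.fintypeV CSM.fintypeU

namespace CSM

variable {n : ℕ}

theorem wellFounded_pa (M : CSM.{u, v} n) : WellFounded (fun j i => j ∈ M.pa i) := by
  have : Std.Irrefl (Relation.TransGen (fun j k => j ∈ M.pa k)) := ⟨M.acyclic⟩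
  exact Subrelation.wf (fun h => Relation.TransGen.single h)
    (Finite.wellFounded_of_trans_of_irrefl (Relation.TransGen (fun j k => j ∈ M.pa k)))

/-- The values `V(u)` of the endogenous variables: the (unique) solution of the structural
equations in the situation `u`, computed by recursion along the causal graph. -/
def solution (M : CSM.{u, v} n) (u : ∀ i, M.U i) : ∀ i, M.V i :=
  M.wellFounded_pa.fix (fun i val => M.f i (fun j => val j.1 j.2) (u i))

/-- `solution` does solve the structural equations. -/
theorem solution_eq (M : CSM.{u, v} n) (u : ∀ i, M.U i) (i : Fin n) :
    M.solution u i = M.f i (fun j => M.solution u j.1) (u i) :=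
  M.wellFounded_pa.fix_eq _ i

end CSM

/-- A probabilistic structural causal model: a structural causal model with a probability
distribution `P(u)` on the exogenous variables. -/
structure PSM (n : ℕ) extends CSM.{u, v} n where
  P : (∀ i, U i) → ℝ
  P_nonneg : ∀ u, 0 ≤ P u
  P_sum : ∑ u, P u = 1

namespace PSM

variable {n : ℕ}

open Classical in
/-- The marginal `P(u_i)` of `P(u)`. -/
def marginal (M : PSM.{u, v} n) (i : Fin n) (a : M.U i) : ℝ :=
  ∑ u : ∀ i, M.U i, if u i = a then M.P u else 0

/-- The exogenous variables are independent, `P(u) = ∏ i, P(u_i)`. -/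
def Independent (M : PSM.{u, v} n) : Prop :=
  ∀ u, M.P u = ∏ i, M.marginal i (u i)

open Classical in
/-- The distribution of the endogenous variables, `P(v) = ∑_{u | V(u) = v} P(u)`. -/
def endoProb (M : PSM.{u, v} n) (v : ∀ i, M.V i) : ℝ :=
  ∑ u : ∀ i, M.U i, if M.solution u = v then M.P u else 0

open Classical in
/-- The summand `∏ i, δ_{v_i, f_i(pa_i, u_i)} P(u_i)`. -/
def markovTerm (M : PSM.{u, v} n) (v : ∀ i, M.V i) (u : ∀ i, M.U i) : ℝ :=
  ∏ i, (if v i = M.f i (fun j => v j.1) (u i) then 1 else 0) * M.marginal i (u i)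

end PSM

/-! ## Finite-dimensional quantum systems, channels and Choi operators -/

/-- A non-zero finite-dimensional Hilbert space `ℂ^idx` with its computational orthonormal basis
`|x⟩`, `x : idx`; operators are matrices indexed by `idx`. -/
structure QSystem where
  idx : Type
  [fintype : Fintype idx]
  [decEq : DecidableEq idx]
  [nonempty : Nonempty idx]

attribute [instance] QSystem.fintype QSystem.decEq QSystem.nonempty

/-- A quantum node: an incoming and an outgoing Hilbert space. -/
structure QNode where
  inn : QSystem
  out : QSystem

section Channels

variable {a b : Type} [Fintype a] [DecidableEq a] [Fintype b] [DecidableEq b]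

/-- `id ⊗ E`, where the identity acts on an ancilla of dimension `m`. -/
def amplify (m : ℕ) (E : Matrix a a ℂ →ₗ[ℂ] Matrix b b ℂ)
    (X : Matrix (Fin m × a) (Fin m × a) ℂ) : Matrix (Fin m × b) (Fin m × b) ℂ :=
  Matrix.of fun p q => E (Matrix.of fun x y => X (p.1, x) (q.1, y)) p.2 q.2

/-- Complete positivity. -/
def IsCP (E : Matrix a a ℂ →ₗ[ℂ] Matrix b b ℂ) : Prop :=
  ∀ (m : ℕ) (X : Matrix (Fin m × a) (Fin m × a) ℂ), X.PosSemidef → (amplify m E X).PosSemidef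

/-- Quantum channels: completely positive trace-preserving maps. -/
def IsChannel (E : Matrix a a ℂ →ₗ[ℂ] Matrix b b ℂ) : Prop :=
  IsCP E ∧ ∀ X, (E X).trace = X.trace

/-- Density operators. -/
def IsDensity (ρ : Matrix a a ℂ) : Prop := ρ.PosSemidef ∧ ρ.trace = 1

/-- The map `X ↦ W X W†`. -/
def conjMap (W : Matrix b a ℂ) : Matrix a a ℂ →ₗ[ℂ] Matrix b b ℂ where
  toFun X := W * X * W.conjTranspose
  map_add' X Y := by rw [Matrix.mul_add, Matrix.add_mul]
  map_smul' c X := by simp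

/-- `W` is a unitary from `ℂ^a` onto `ℂ^b`. -/
def IsUnitaryMap (W : Matrix b a ℂ) : Prop :=
  W.conjTranspose * W = 1 ∧ W * W.conjTranspose = 1

/-- The Choi operator `ρ^E = ∑_{x,y} E(|x⟩⟨y|) ⊗ |x⟩⟨y|` of a process `E : L(ℂ^a) → L(ℂ^b)`. -/
def choi (E : Matrix a a ℂ →ₗ[ℂ] Matrix b b ℂ) : Matrix (b × a) (b × a) ℂ :=
  ∑ x, ∑ y, E (Matrix.single x y 1) ⊗ₖ Matrix.single x y 1

/-- The Choi operator `τ = ∑_{x,y} T(|x⟩⟨y|)ᵀ ⊗ |y⟩⟨x|` of an intervention `T` at a node with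
incoming space `ℂ^a` and outgoing space `ℂ^b`. -/
def choiNode (T : Matrix a a ℂ →ₗ[ℂ] Matrix b b ℂ) : Matrix (b × a) (b × a) ℂ :=
  ∑ x, ∑ y, (T (Matrix.single x y 1)).transpose ⊗ₖ Matrix.single y x 1

/-- The discard-and-prepare map `X ↦ p tr(X) ρ`. -/
def discardPrepare (a : Type) [Fintype a] [DecidableEq a] (p : ℝ) (ρ : Matrix b b ℂ) :
    Matrix a a ℂ →ₗ[ℂ] Matrix b b ℂ :=
  (Matrix.traceLinearMap a ℂ ℂ).smulRight ((p : ℂ) • ρ)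

/-- The operation `X ↦ |w⟩⟨w| X |w⟩⟨w|` belonging to the outcome `w` of the projective measurement
in the computational basis. -/
def measureMap (w : a) : Matrix a a ℂ →ₗ[ℂ] Matrix a a ℂ :=
  conjMap (Matrix.single w w 1)

/-- No influence from `A` to `D` through `U : A ⊗ B → C ⊗ D`: there is a channel
`E : L(B) → L(D)` with `tr_C ρ^U_{CD|AB} = ρ^E_{D|B} ⊗ 𝟙_A`. The maps `eX`, `eY` exhibit the domain
and the codomain of `U` as `A ⊗ B` and as `C ⊗ D`. -/
def NoInfluence {A B C D X Y : Type}
    [Fintype A] [DecidableEq A] [Fintype B] [DecidableEq B] [Fintype C] [DecidableEq C]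
    [Fintype D] [DecidableEq D] [Fintype X] [DecidableEq X] [Fintype Y] [DecidableEq Y]
    (eX : X ≃ A × B) (eY : Y ≃ C × D) (U : Matrix Y X ℂ) : Prop :=
  ∃ E : Matrix B B ℂ →ₗ[ℂ] Matrix D D ℂ, IsChannel E ∧
    ∀ (x x' : A) (y y' : B) (d d' : D),
      ∑ c : C, choi (conjMap U) (eY.symm (c, d), eX.symm (x, y)) (eY.symm (c, d'), eX.symm (x', y'))
        = choi E (d, y) (d', y') * (1 : Matrix A A ℂ) x x'

end Channels

/-- The tensor product of a finite family of operators. -/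
def tensorPi {n : ℕ} {a : Fin n → Type} (T : ∀ i, Matrix (a i) (a i) ℂ) :
    Matrix (∀ i, a i) (∀ i, a i) ℂ :=
  Matrix.of fun x y => ∏ i, T i (x i) (y i)

/-! ## Quantum structural causal models -/

section Quantum

variable {n : ℕ}

/-- Basis of the codomain of the process, `⨂ A_i^in ⊗ S^in`. -/
abbrev TargetIdx (A : Fin n → QNode) (S : QSystem) : Type :=
  (∀ i, (A i).inn.idx) × S.idx

/-- Basis of the domain of the process, `⨂ A_i^out ⊗ ⨂ Λ_i^out`. -/
abbrev SourceIdx (A Λ : Fin n → QNode) : Type :=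
  (∀ i, (A i).out.idx) × (∀ i, (Λ i).out.idx)

/-- Regrouping of the tensor factors node by node. -/
def nodewise {A Λ : Fin n → QNode} {S : QSystem}
    (x : (TargetIdx A S × SourceIdx A Λ) × (∀ i, (Λ i).inn.idx)) :
    ((∀ i, (A i).out.idx × (A i).inn.idx) × (∀ i, (Λ i).out.idx × (Λ i).inn.idx)) × S.idx :=
  ((fun i => (x.1.2.1 i, x.1.1.1 i), fun i => (x.1.2.2 i, x.2 i)), x.1.1.2)

/-- The generalised Born rule `tr[(ρ ⊗ 𝟙_{Λ^in}) (⨂ τ_{A_i} ⊗ ⨂ τ_{Λ_i} ⊗ 𝟙_{S^in})]`, the trace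
being over all spaces `A_i^in`, `A_i^out`, `Λ_i^in`, `Λ_i^out` and `S^in`. -/
def born {A Λ : Fin n → QNode} {S : QSystem}
    (ρ : Matrix (TargetIdx A S × SourceIdx A Λ) (TargetIdx A S × SourceIdx A Λ) ℂ)
    (τA : ∀ i, Matrix ((A i).out.idx × (A i).inn.idx) ((A i).out.idx × (A i).inn.idx) ℂ)
    (τΛ : ∀ i, Matrix ((Λ i).out.idx × (Λ i).inn.idx) ((Λ i).out.idx × (Λ i).inn.idx) ℂ) : ℂ :=
  Matrix.trace ((ρ ⊗ₖ (1 : Matrix (∀ i, (Λ i).inn.idx) (∀ i, (Λ i).inn.idx) ℂ)) *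
    ((tensorPi τA ⊗ₖ tensorPi τΛ) ⊗ₖ (1 : Matrix S.idx S.idx ℂ)).submatrix nodewise nodewise)

/-- The normalised Choi operator `p ρᵀ ⊗ 𝟙 / dim Λ^in` of the discard-and-prepare operation that
prepares `ρ` with probability `p` at the node `Λ`. -/
def preparation (Λ : QNode) (p : ℝ) (ρ : Matrix Λ.out.idx Λ.out.idx ℂ) :
    Matrix (Λ.out.idx × Λ.inn.idx) (Λ.out.idx × Λ.inn.idx) ℂ :=
  ((Fintype.card Λ.inn.idx : ℂ)⁻¹) • choiNode (discardPrepare Λ.inn.idx p ρ)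

/-- `choiNode` of a discard-and-prepare operation is `p ρᵀ ⊗ 𝟙`. -/
theorem choiNode_discardPrepare {a b : Type} [Fintype a] [DecidableEq a] [Fintype b]
    [DecidableEq b] (p : ℝ) (ρ : Matrix b b ℂ) :
    choiNode (discardPrepare a p ρ) = ((p : ℂ) • ρ.transpose) ⊗ₖ (1 : Matrix a a ℂ) := by
  ext ⟨o, i⟩ ⟨o', i'⟩
  simp only [choiNode, discardPrepare, Matrix.sum_apply, Matrix.kroneckerMap_apply,
    LinearMap.smulRight_apply, Matrix.traceLinearMap_apply, Matrix.transpose_apply,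
    Matrix.smul_apply, Matrix.single_apply, Matrix.one_apply, smul_eq_mul]
  rw [Finset.sum_eq_single i' (by intro x _ hx; simp [hx]) (by simp),
    Finset.sum_eq_single i (by intro x _ hx; simp [hx]) (by simp)]
  by_cases h : i = i'
  · subst h; simp
  · rw [Matrix.trace_single_eq_of_ne _ _ _ (Ne.symm h)]; simp [h]

/-- Normalisation of the process: the total probability is one for all channels at the endogenous
nodes and all states prepared at the exogenous nodes. -/
def IsNormalised {A Λ : Fin n → QNode} {S : QSystem}
    (U : Matrix (TargetIdx A S) (SourceIdx A Λ) ℂ) : Prop :=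
  ∀ (T : ∀ i, Matrix (A i).inn.idx (A i).inn.idx ℂ →ₗ[ℂ] Matrix (A i).out.idx (A i).out.idx ℂ)
    (ρ : ∀ i, Matrix (Λ i).out.idx (Λ i).out.idx ℂ),
    (∀ i, IsChannel (T i)) → (∀ i, IsDensity (ρ i)) →
      born (choi (conjMap U)) (fun i => choiNode (T i)) (fun i => preparation (Λ i) 1 (ρ i)) = 1

/-- The domain of the process as `Λ_j^out ⊗ (everything else)`. -/
def splitSource (A Λ : Fin n → QNode) (j : Fin n) :
    SourceIdx A Λ ≃
      (Λ j).out.idx × ((∀ i, (A i).out.idx) × (∀ k : {k // k ≠ j}, (Λ k.1).out.idx)) :=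
  (Equiv.prodCongr (Equiv.refl _) (Equiv.piSplitAt j fun k => (Λ k).out.idx)).trans
    ⟨fun x => (x.2.1, (x.1, x.2.2)), fun y => (y.2.1, (y.1, y.2.2)), fun _ => rfl, fun _ => rfl⟩

/-- The codomain of the process as `(everything else) ⊗ A_i^in`. -/
def splitTarget (A : Fin n → QNode) (S : QSystem) (i : Fin n) :
    TargetIdx A S ≃ ((∀ k : {k // k ≠ i}, (A k.1).inn.idx) × S.idx) × (A i).inn.idx :=
  (Equiv.prodCongr (Equiv.piSplitAt i fun k => (A k).inn.idx) (Equiv.refl _)).trans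
    ⟨fun x => ((x.1.2, x.2), x.1.1), fun y => ((y.2, y.1.1), y.1.2), fun _ => rfl, fun _ => rfl⟩

/-- A quantum structural causal model with endogenous nodes `A i`, exogenous nodes `Λ i` and a sink
with incoming space `S`: a unitary process `U` from the outgoing spaces of the nodes `A i`, `Λ i`
to the incoming spaces of the nodes `A i` and of the sink, without influence of `Λ j` on `A i` for
`j ≠ i`; and, for every exogenous node, a discard-and-prepare instrument with outcomes in `L i`,
which prepares the state `state i l` with probability `prob i l`. -/
structure QSM (A Λ : Fin n → QNode) (S : QSystem) (L : Fin n → Type u) [∀ i, Fintype (L i)] where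
  U : Matrix (TargetIdx A S) (SourceIdx A Λ) ℂ
  unitary : IsUnitaryMap U
  normalised : IsNormalised U
  noInfluence : ∀ i j, j ≠ i → NoInfluence (splitSource A Λ j) (splitTarget A S i) U
  prob : ∀ i, L i → ℝ
  prob_nonneg : ∀ i l, 0 ≤ prob i l
  prob_sum : ∀ i, ∑ l, prob i l = 1
  state : ∀ i, L i → Matrix (Λ i).out.idx (Λ i).out.idx ℂ
  state_density : ∀ i l, IsDensity (state i l)

namespace QSM

variable {A Λ : Fin n → QNode} {S : QSystem} {L : Fin n → Type u} [∀ i, Fintype (L i)]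

/-- The process operator `ρ^U_{AS|AΛ}`. -/
def process (Q : QSM A Λ S L) :
    Matrix (TargetIdx A S × SourceIdx A Λ) (TargetIdx A S × SourceIdx A Λ) ℂ :=
  choi (conjMap Q.U)

/-- The normalised instrument elements at the exogenous nodes. -/
def instrument (Q : QSM A Λ S L) (i : Fin n) (l : L i) :
    Matrix ((Λ i).out.idx × (Λ i).inn.idx) ((Λ i).out.idx × (Λ i).inn.idx) ℂ :=
  preparation (Λ i) (Q.prob i l) (Q.state i l)

end QSM

end Quantum

/-! ## Quantum nodes carrying copies of classical variables -/

namespace CSM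

variable {n : ℕ}

/-- The basis of `N_i` qubits, `N_i = ⌈log₂ |V_i|⌉`. -/
abbrev Bits (M : CSM.{u, v} n) (i : Fin n) : Type :=
  Fin (Nat.clog 2 (Fintype.card (M.V i))) → Bool

/-- Nodes without children. -/
abbrev Leaf (M : CSM.{u, v} n) : Type := {i : Fin n // ∀ j, i ∉ M.pa j}

/-- Labels of the copies of `V_i`: one for every child of `i`; a single one if `i` has no child. -/
abbrev CopyIdx (M : CSM.{u, v} n) (i : Fin n) : Type :=
  {j : Fin n // i ∈ M.pa j} ⊕ {_x : Unit // ∀ j, i ∉ M.pa j}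

/-- The Hilbert space of all copies of `V_i`, each consisting of `N_i` qubits. -/
def copySystem (M : CSM.{u, v} n) (i : Fin n) : QSystem where
  idx := M.CopyIdx i → M.Bits i

/-- The quantum node of `V_i`. -/
def copyNode (M : CSM.{u, v} n) (i : Fin n) : QNode := ⟨M.copySystem i, M.copySystem i⟩

/-- The copies that node `i` receives from its parents: one from each parent. -/
def parentSystem (M : CSM.{u, v} n) (i : Fin n) : QSystem where
  idx := ∀ j : {j // j ∈ M.pa i}, M.Bits j.1

/-- What leaves the nodes without children; it passes unchanged to the sink. -/
def leafSystem (M : CSM.{u, v} n) : QSystem where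
  idx := ∀ i : M.Leaf, M.Bits i.1

/-- The sink: local sinks `S i`, and the outputs of the nodes without children. -/
def sinkSystem (M : CSM.{u, v} n) (S : Fin n → QSystem) : QSystem where
  idx := (∀ i, (S i).idx) × M.leafSystem.idx

/-- The copy sent to child `i` by each of its parents. -/
def toChild (M : CSM.{u, v} n) (x : ∀ i, (M.copyNode i).out.idx) (i : Fin n) :
    (M.parentSystem i).idx :=
  fun j => x j.1 (Sum.inl ⟨i, j.2⟩)

/-- The outputs of the nodes without children. -/
def toLeaves (M : CSM.{u, v} n) (x : ∀ i, (M.copyNode i).out.idx) : M.leafSystem.idx :=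
  fun i => x i.1 (Sum.inr ⟨(), i.2⟩)

/-- Regrouping of the tensor factors of the process: for every node `i`, the factors
`V_i^in`, `S_i` | `Pa_i`, `Λ_i`; and the pass-through factors of the nodes without children. -/
def regroup (M : CSM.{u, v} n) (Λ : Fin n → QNode) (S : Fin n → QSystem)
    (x : TargetIdx M.copyNode (M.sinkSystem S) × SourceIdx M.copyNode Λ) :
    (∀ i, ((M.copyNode i).inn.idx × (S i).idx) × ((M.parentSystem i).idx × (Λ i).out.idx)) ×
      (M.leafSystem.idx × M.leafSystem.idx) :=
  (fun i => ((x.1.1 i, x.1.2.1 i), (M.toChild x.2.1 i, x.2.2 i)), (x.1.2.2, M.toLeaves x.2.1))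

/-- The Choi operator `|w⟩⟨w| ⊗ |w⟩⟨w|`, `|w⟩ = |v_i⟩ ⊗ ⋯ ⊗ |v_i⟩`, of the outcome `v_i` of the
projective measurement of the node `V_i` in the copied computational basis, the value `v_i` being
written as a bit string by `e`. -/
def copyMeasurement (M : CSM.{u, v} n) (i : Fin n) (e : M.V i ↪ M.Bits i) (a : M.V i) :
    Matrix ((M.copyNode i).out.idx × (M.copyNode i).inn.idx)
      ((M.copyNode i).out.idx × (M.copyNode i).inn.idx) ℂ :=
  choiNode (measureMap (a := (M.copySystem i).idx) (fun _ => e a))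

end CSM

end

/-!
A classical mechanism `v_i = f_i(pa_i, u_i)` is made reversible by keeping its arguments. The node
`Λ_i` sends a register for `u_i` together with an ancilla prepared in a fixed basis state `y₀`; the
unitary `W_i` permutes the ancilla, controlled by the copies received from the parents and by the
register, so that `y₀` becomes the copies of `f_i(pa_i, u_i)`. The ancilla goes to the node `V_i`,
and the controls go to the local sink `S_i`. The process is the product of the `W_i`, wired so that
each outgoing copy reaches its child; it permutes the computational basis (`CSM.globalPerm`), so it
is unitary and factorises node by node (`CSM.process_factorisation`).

All outgoing copies end up in the sink, so discarding the sink decoheres them. The Born rule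
therefore becomes a sum over classical labels of a product of kernels, one for each node, each
depending only on the label of the node and the labels of its parents (`CSM.born_globalPerm`). For
channels at the nodes and normalised states at the `Λ_i`, the kernels have total mass one because
channels preserve the trace, and by acyclicity so has their product
(`sum_prod_causal_kernels`); this is the normalisation of the process. For measurements in the
copied basis, the only label left is the measured one, and the product is the classical product
`∏ i, δ_{v_i, f_i(pa_i, u_i)} P(u_i)` (`CSM.born_measure`).

The node `Λ_j` does not influence `V_i` for `j ≠ i`: after everything but `V_i` is discarded, only a
controlled permutation of the ancilla of `Λ_i` is left (`CSM.noInfluence_globalPerm`).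
-/

noncomputable section

/-! ### Products of kernels along an acyclic graph -/

section CausalKernels

variable {ι : Type*} [Fintype ι] [DecidableEq ι] {X : ι → Type*} [∀ i, Fintype (X i)]

/-- Two functions on a finite product have equal sums if their sums along each line in one fixed
coordinate direction agree. -/
theorem sum_pi_congr_coord {f g : (∀ i, X i) → ℂ} (m : ι)
    (h : ∀ x, ∑ a, f (Function.update x m a) = ∑ a, g (Function.update x m a)) :
    ∑ x, f x = ∑ x, g x := by
  rcases isEmpty_or_nonempty (X m) with hm | ⟨⟨a₀⟩⟩
  · have : IsEmpty (∀ i, X i) := ⟨fun x => hm.elim (x m)⟩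
    simp
  have key : ∀ F : (∀ i, X i) → ℂ, ∑ x, F x =
      ∑ y : ∀ j : {j // j ≠ m}, X j.1,
        ∑ a, F (Function.update ((Equiv.piSplitAt m X).symm (a₀, y)) m a) := by
    intro F
    rw [← (Equiv.piSplitAt m X).symm.sum_comp F, Fintype.sum_prod_type, Finset.sum_comm]
    refine Finset.sum_congr rfl fun y _ => Finset.sum_congr rfl fun a _ => congrArg F ?_
    funext i
    by_cases hi : i = m
    · subst hi; simp
    · simp [hi]
  rw [key f, key g]
  exact Finset.sum_congr rfl fun y _ => h _

/-- A product of kernels `κ i`, each depending only on the parents of `i` (`R j i` meaning that `j`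
is a parent of `i`) and with constant total mass `c i`, has total mass `∏ i, c i` if the graph is
acyclic. Kernels are replaced one at a time by point masses at a reference value, a node without
remaining children going first: no other remaining kernel then sees its value. -/
theorem sum_prod_causal_kernels {R : ι → ι → Prop} (hR : WellFounded (flip R))
    (κ : ∀ i, (∀ j, X j) → X i → ℂ) (c : ι → ℂ)
    (hκ : ∀ i x x', (∀ j, R j i → x j = x' j) → κ i x = κ i x')
    (hc : ∀ i x, ∑ a, κ i x a = c i) [hX : ∀ i, Nonempty (X i)] :
    ∑ x, ∏ i, κ i x (x i) = ∏ i, c i := by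
  classical
  have x₀ : ∀ i, X i := fun i => (hX i).some
  -- `s` holds the nodes whose kernels are still in place; it is closed under taking parents.
  have claim : ∀ s : Finset ι, (∀ i ∈ s, ∀ j, R j i → j ∈ s) →
      ∑ x : ∀ i, X i, ∏ i, (if i ∈ s then κ i x (x i) else if x i = x₀ i then c i else 0)
        = ∏ i, c i := by
    intro s
    induction s using Finset.strongInduction with
    | H s ih =>
      intro hs
      rcases s.eq_empty_or_nonempty with rfl | hne
      · simp only [Finset.notMem_empty, if_false]
        rw [Finset.sum_eq_single x₀]
        · simp
        · intro x _ hx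
          obtain ⟨i, hi⟩ := Function.ne_iff.1 hx
          exact Finset.prod_eq_zero (Finset.mem_univ i) (by simp [hi])
        · simp
      · obtain ⟨m, hm, hmax⟩ := hR.has_min (s : Set ι) hne
        have hms : m ∈ s := hm
        have hmax' : ∀ i ∈ s, ¬ R m i := fun i hi h => hmax i hi h
        rw [← ih (s.erase m) (Finset.erase_ssubset hms)]
        · refine sum_pi_congr_coord m fun x => ?_
          have hprod : ∀ (G : ∀ i, (∀ j, X j) → ℂ) (B : ℂ),
              (∀ i, i ≠ m → ∀ a, G i (Function.update x m a) = G i x) →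
              (∑ a, G m (Function.update x m a) = B) →
              ∑ a, ∏ i, G i (Function.update x m a)
                = B * ∏ i ∈ Finset.univ.erase m, G i x := by
            intro G B h1 h2
            rw [← h2, Finset.sum_mul]
            refine Finset.sum_congr rfl fun a _ => ?_
            rw [← Finset.mul_prod_erase _ _ (Finset.mem_univ m)]
            congr 1
            exact Finset.prod_congr rfl fun i hi => h1 i (Finset.ne_of_mem_erase hi) a
          have hind : ∀ i ∈ s, ∀ a, κ i (Function.update x m a) = κ i x := by
            intro i hi a
            refine hκ i _ _ fun j hj => Function.update_of_ne ?_ _ _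
            rintro rfl
            exact hmax' i hi hj
          rw [hprod (fun i x => if i ∈ s then κ i x (x i) else if x i = x₀ i then c i else 0)
              (c m), hprod (fun i x => if i ∈ s.erase m then κ i x (x i) else
                if x i = x₀ i then c i else 0) (c m)]
          · congr 1
            refine Finset.prod_congr rfl fun i hi => ?_
            simp [Finset.mem_erase, Finset.ne_of_mem_erase hi]
          · intro i hi a
            simp only [Function.update_of_ne hi]
            split_ifs with h
            · rw [hind i (Finset.mem_of_mem_erase h)]
            all_goals rfl
          · simp
          · intro i hi a
            simp only [Function.update_of_ne hi]
            split_ifs with h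
            · rw [hind i h]
            all_goals rfl
          · simp only [if_pos hms, hind m hms, Function.update_self]
            exact hc m x
        · intro i hi j hj
          refine Finset.mem_erase.2 ⟨?_, hs i (Finset.mem_of_mem_erase hi) j hj⟩
          rintro rfl
          exact hmax' i (Finset.mem_of_mem_erase hi) hj
  simpa using claim Finset.univ (by simp)

end CausalKernels

/-! ### Unitaries that permute the computational basis -/

section Permutations

variable {a b c d : Type}

theorem choi_apply [Fintype a] [DecidableEq a] (E : Matrix a a ℂ →ₗ[ℂ] Matrix b b ℂ) (p q : b × a) :
    choi E p q = E (Matrix.single p.2 q.2 1) p.1 q.1 := by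
  simp only [choi, Matrix.sum_apply, Matrix.kroneckerMap_apply, Matrix.single_apply]
  rw [Finset.sum_eq_single p.2 (by intro x _ hx; simp [hx]) (by simp),
    Finset.sum_eq_single q.2 (by intro x _ hx; simp [hx]) (by simp)]
  simp

theorem choiNode_apply [Fintype a] [DecidableEq a] (T : Matrix a a ℂ →ₗ[ℂ] Matrix b b ℂ)
    (p q : b × a) :
    choiNode T p q = T (Matrix.single q.2 p.2 1) q.1 p.1 := by
  simp only [choiNode, Matrix.sum_apply, Matrix.kroneckerMap_apply, Matrix.single_apply,
    Matrix.transpose_apply]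
  rw [Finset.sum_eq_single q.2 (by intro x _ hx; simp [hx]) (by simp),
    Finset.sum_eq_single p.2 (by intro x _ hx; simp [hx]) (by simp)]
  simp

theorem choi_conjMap_apply [Fintype a] [DecidableEq a] (W : Matrix b a ℂ) (p q : b × a) :
    choi (conjMap W) p q = W p.1 p.2 * star (W q.1 q.2) := by
  rw [choi_apply]
  change (W * Matrix.single p.2 q.2 (1 : ℂ) * W.conjTranspose) p.1 q.1 = _
  rw [Matrix.mul_apply, Finset.sum_eq_single q.2]
  · simp
  · intro x _ hx
    have : (W * Matrix.single p.2 q.2 (1 : ℂ)) p.1 x = 0 := by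
      simp [Matrix.mul_apply, hx.symm]
    rw [this, zero_mul]
  · simp

/-- The unitary that permutes the computational basis by `|x⟩ ↦ |σ x⟩`. -/
def permMatrix [DecidableEq b] (σ : a ≃ b) : Matrix b a ℂ := (1 : Matrix b b ℂ).submatrix id σ

theorem permMatrix_apply [DecidableEq b] (σ : a ≃ b) (y : b) (x : a) :
    permMatrix σ y x = if y = σ x then 1 else 0 := by
  simp [permMatrix, Matrix.one_apply]

theorem isUnitaryMap_permMatrix [Fintype a] [DecidableEq a] [Fintype b] [DecidableEq b] (σ : a ≃ b) :
    IsUnitaryMap (permMatrix σ) := by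
  constructor
  · ext x y
    simp [Matrix.mul_apply, permMatrix_apply, Matrix.one_apply, eq_comm (a := y)]
  · ext x y
    simp only [Matrix.mul_apply, permMatrix_apply, Matrix.conjTranspose_apply]
    rw [← σ.symm.sum_comp]
    simp [Matrix.one_apply]

theorem choi_permMatrix_apply [Fintype a] [DecidableEq a] [DecidableEq b] (σ : a ≃ b) (p q : b × a) :
    choi (conjMap (permMatrix σ)) p q = if p.1 = σ p.2 ∧ q.1 = σ q.2 then 1 else 0 := by
  rw [choi_conjMap_apply, permMatrix_apply, permMatrix_apply]
  by_cases h : p.1 = σ p.2 <;> by_cases h' : q.1 = σ q.2 <;> simp [h, h']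

/-- The map that permutes the computational basis by `τ` and then discards the first tensor
factor. -/
def permTrace [Fintype c] (τ : b ≃ c × d) : Matrix b b ℂ →ₗ[ℂ] Matrix d d ℂ where
  toFun X := ∑ z, X.submatrix (fun w => τ.symm (z, w)) (fun w => τ.symm (z, w))
  map_add' X Y := by simp [Matrix.submatrix_add, Finset.sum_add_distrib]
  map_smul' r X := by simp [Matrix.submatrix_smul, Finset.smul_sum]

theorem permTrace_apply [Fintype c] (τ : b ≃ c × d) (X : Matrix b b ℂ) (w w' : d) :
    permTrace τ X w w' = ∑ z, X (τ.symm (z, w)) (τ.symm (z, w')) := by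
  change (∑ z, X.submatrix (fun w => τ.symm (z, w)) (fun w => τ.symm (z, w))) w w' = _
  simp [Matrix.sum_apply]

theorem isChannel_permTrace [Fintype b] [DecidableEq b] [Fintype c]
    [Fintype d] [DecidableEq d] (τ : b ≃ c × d) : IsChannel (permTrace τ) := by
  constructor
  · intro m X hX
    have : amplify m (permTrace τ) X =
        ∑ z, X.submatrix (fun p => (p.1, τ.symm (z, p.2))) (fun p => (p.1, τ.symm (z, p.2))) := by
      ext p q
      simp [amplify, permTrace_apply, Matrix.sum_apply]
    rw [this]
    exact Matrix.posSemidef_sum _ fun z _ => hX.submatrix _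
  · intro X
    simp only [Matrix.trace, Matrix.diag, permTrace_apply]
    rw [← τ.symm.sum_comp, Fintype.sum_prod_type, Finset.sum_comm]

theorem choi_permTrace_apply [Fintype b] [DecidableEq b] [Fintype c] [DecidableEq c]
    [DecidableEq d] (τ : b ≃ c × d) (p q : d × b) :
    choi (permTrace τ) p q =
      if (τ p.2).1 = (τ q.2).1 ∧ p.1 = (τ p.2).2 ∧ q.1 = (τ q.2).2 then 1 else 0 := by
  rw [choi_apply, permTrace_apply]
  have : ∀ z, (Matrix.single p.2 q.2 1 : Matrix b b ℂ) (τ.symm (z, p.1)) (τ.symm (z, q.1)) =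
      if z = (τ p.2).1 then
        (if (τ p.2).1 = (τ q.2).1 ∧ p.1 = (τ p.2).2 ∧ q.1 = (τ q.2).2 then 1 else 0) else 0 := by
    intro z
    rw [Matrix.single_apply, ← ite_and]
    refine if_congr ?_ rfl rfl
    rw [Equiv.eq_symm_apply, Equiv.eq_symm_apply, Prod.ext_iff, Prod.ext_iff]
    grind
  simp [this]

/-- A basis permutation `σ` has no influence from `A` to `D` if its `D`-part is a function of the
`B`-label alone, and the remaining output label records the `A`-label together with exactly the
part of the `B`-label that the channel `permTrace τ` discards. -/
theorem noInfluence_permMatrix {X Y B C D K : Type} [Fintype a] [DecidableEq a]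
    [Fintype B] [DecidableEq B] [Fintype C]
    [DecidableEq C] [Fintype D] [DecidableEq D] [Fintype X] [DecidableEq X] [Fintype Y]
    [DecidableEq Y] [Fintype K] [DecidableEq K] (eX : X ≃ a × B) (eY : Y ≃ C × D) (σ : X ≃ Y)
    (τ : B ≃ K × D) (h₂ : ∀ x y, (eY (σ (eX.symm (x, y)))).2 = (τ y).2)
    (h₁ : ∀ x y x' y', (eY (σ (eX.symm (x, y)))).1 = (eY (σ (eX.symm (x', y')))).1 ↔
      x = x' ∧ (τ y).1 = (τ y').1) :
    NoInfluence eX eY (permMatrix σ) := by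
  refine ⟨permTrace τ, isChannel_permTrace τ, fun x x' y y' w w' => ?_⟩
  have : ∀ z, choi (conjMap (permMatrix σ)) (eY.symm (z, w), eX.symm (x, y))
      (eY.symm (z, w'), eX.symm (x', y')) =
      if z = (eY (σ (eX.symm (x, y)))).1 then
        (if (τ y).1 = (τ y').1 ∧ w = (τ y).2 ∧ w' = (τ y').2 then 1 else 0) *
          (if x = x' then 1 else 0) else 0 := by
    intro z
    rw [choi_permMatrix_apply]
    simp only [Equiv.symm_apply_eq, Prod.ext_iff, h₂, ite_and, mul_ite, mul_one, mul_zero]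
    have := h₁ x y x' y'
    grind
  simp [this, choi_permTrace_apply, Matrix.one_apply]

end Permutations

/-! ### The Born rule for a process that permutes the computational basis -/

section BornRule

variable {n : ℕ} {A Λ : Fin n → QNode} {S : QSystem}

theorem preparation_apply (N : QNode) (p : ℝ) (ρ : Matrix N.out.idx N.out.idx ℂ)
    (x y : N.out.idx × N.inn.idx) :
    preparation N p ρ x y =
      (Fintype.card N.inn.idx : ℂ)⁻¹ * (p * ρ y.1 x.1 * if x.2 = y.2 then 1 else 0) := by
  simp [preparation, choiNode_discardPrepare, Matrix.kroneckerMap_apply, Matrix.one_apply]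

/-- The Born rule for a basis permutation, as a sum over pairs of source labels: discarding the sink
leaves the pairs with the same sink label. -/
theorem born_permMatrix (σ : SourceIdx A Λ ≃ TargetIdx A S)
    (τA : ∀ i, Matrix ((A i).out.idx × (A i).inn.idx) ((A i).out.idx × (A i).inn.idx) ℂ)
    (p : Fin n → ℝ) (ρ : ∀ i, Matrix (Λ i).out.idx (Λ i).out.idx ℂ) :
    born (choi (conjMap (permMatrix σ))) τA (fun i => preparation (Λ i) (p i) (ρ i)) =
      ∑ s, ∑ s', if (σ s).2 = (σ s').2 then
        ∏ i, (τA i (s'.1 i, (σ s').1 i) (s.1 i, (σ s).1 i) * (p i * ρ i (s.2 i) (s'.2 i)))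
        else 0 := by
  -- Summing over the discarded inputs of the exogenous nodes cancels the dimension factors.
  have hprep : ∀ s s' : SourceIdx A Λ,
      ∑ l : ∀ i, (Λ i).inn.idx, ∏ i, preparation (Λ i) (p i) (ρ i) (s'.2 i, l i) (s.2 i, l i) =
        ∏ i, (p i * ρ i (s.2 i) (s'.2 i)) := by
    intro s s'
    have h0 := Finset.prod_univ_sum (fun i => (Finset.univ : Finset (Λ i).inn.idx))
      (fun i l => preparation (Λ i) (p i) (ρ i) (s'.2 i, l) (s.2 i, l))
    rw [Fintype.piFinset_univ] at h0
    rw [← h0]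
    refine Finset.prod_congr rfl fun i _ => ?_
    simp only [preparation_apply, if_true, mul_one, Finset.sum_const, Finset.card_univ,
      nsmul_eq_mul]
    rw [← mul_assoc, mul_inv_cancel₀ (Nat.cast_ne_zero.2 Fintype.card_ne_zero), one_mul]
  have collapse : ∀ F : (TargetIdx A S × SourceIdx A Λ) × (∀ i, (Λ i).inn.idx) → ℂ,
      (∀ t s l, t ≠ σ s → F ((t, s), l) = 0) → ∑ q, F q = ∑ s, ∑ l, F ((σ s, s), l) := by
    intro F hF
    rw [Fintype.sum_prod_type, Fintype.sum_prod_type, Finset.sum_comm]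
    refine Finset.sum_congr rfl fun s _ => Finset.sum_eq_single _ (fun t _ ht => ?_) (by simp)
    exact Finset.sum_eq_zero fun l _ => hF t s l ht
  simp only [born, Matrix.trace, Matrix.diag, Matrix.mul_apply]
  -- The trace runs over `q`, the matrix product over a second copy of the same index; in both, the
  -- target index is determined by the source index.
  rw [collapse _ fun t s l h => Finset.sum_eq_zero fun q _ => by
    simp [Matrix.kroneckerMap_apply, choi_permMatrix_apply, h]]
  refine Finset.sum_congr rfl fun s _ => ?_
  have inner : ∀ l, _ := fun l => collapse (fun q =>
    (choi (conjMap (permMatrix σ)) ⊗ₖ (1 : Matrix (∀ i, (Λ i).inn.idx) (∀ i, (Λ i).inn.idx) ℂ))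
      ((σ s, s), l) q * ((tensorPi τA ⊗ₖ tensorPi fun i => preparation (Λ i) (p i) (ρ i)) ⊗ₖ
        (1 : Matrix S.idx S.idx ℂ)).submatrix nodewise nodewise q ((σ s, s), l))
    (fun t s' l' h => by simp [Matrix.kroneckerMap_apply, choi_permMatrix_apply, h])
  rw [Finset.sum_congr rfl fun l _ => inner l, Finset.sum_comm]
  refine Finset.sum_congr rfl fun s' _ => ?_
  simp only [Matrix.kroneckerMap_apply, choi_permMatrix_apply, Matrix.submatrix_apply, nodewise,
    tensorPi, Matrix.of_apply, Matrix.one_apply, and_self, if_true, one_mul, ite_mul, zero_mul,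
    mul_ite, mul_one, mul_zero]
  rw [Finset.prod_mul_distrib, ← hprep s s', Finset.mul_sum]
  by_cases h : (σ s).2 = (σ s').2
  · simp [h]
  · simp [h, Ne.symm h]

end BornRule

/-! ### The process: controlled permutations wired along the causal graph -/

namespace CSM

variable {n : ℕ} (M : CSM.{u, v} n) (K : Fin n → Type) [∀ i, Fintype (K i)]
  [∀ i, DecidableEq (K i)] [∀ i, Nonempty (K i)]

/-- The exogenous node of `V_i`, with basis vectors `|k⟩ ⊗ |y⟩`: a register `k : K i` for the value
of `U_i`, and an ancilla `y` of the size of the node of `V_i`, into which the value of `V_i` is written.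
The incoming space is irrelevant, and is taken equal to the outgoing one. -/
abbrev exoNode (i : Fin n) : QNode :=
  ⟨⟨K i × (M.copySystem i).idx⟩, ⟨K i × (M.copySystem i).idx⟩⟩

/-- The local sink of node `i`, which receives the controls: the copies from the parents and the
register of `U_i`. -/
abbrev localSink (i : Fin n) : QSystem := ⟨(M.parentSystem i).idx × K i⟩

variable {K} (π : ∀ i, (M.parentSystem i).idx → K i → Equiv.Perm (M.copySystem i).idx)

/-- The controlled permutation `(a, (k, y)) ↦ (π i a k y, (a, k))` at node `i`, where `a` are the
copies from the parents. -/
def localPerm (i : Fin n) :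
    (M.parentSystem i).idx × (M.exoNode K i).out.idx ≃
      (M.copyNode i).inn.idx × (M.localSink K i).idx where
  toFun x := (π i x.1 x.2.1 x.2.2, (x.1, x.2.1))
  invFun y := (y.2.1, (y.2.2, (π i y.2.1 y.2.2).symm y.1))
  left_inv x := by
    obtain ⟨x, k, y⟩ := x
    simp
  right_inv y := by
    obtain ⟨y, x, k⟩ := y
    exact Prod.ext (Equiv.apply_symm_apply _ _) rfl

/-- The outgoing copies of all nodes, sorted by destination: every copy either goes to exactly one
child or leaves a node without children. -/
def wiring : (∀ i, (M.copyNode i).out.idx) ≃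
    (∀ i, (M.parentSystem i).idx) × M.leafSystem.idx where
  toFun x := (M.toChild x, M.toLeaves x)
  invFun y := fun i => Sum.elim (fun j => y.1 j.1 ⟨i, j.2⟩) (fun h => y.2 ⟨i, h.2⟩)
  left_inv x := by
    funext i c
    rcases c with c | c <;> rfl
  right_inv y := rfl

/-- The basis permutation of the whole process: the copies are distributed along the causal graph,
and the controlled permutation `π i` acts at every node `i`. -/
def globalPerm :
    SourceIdx M.copyNode (M.exoNode K) ≃ TargetIdx M.copyNode (M.sinkSystem (M.localSink K)) where
  toFun s := (fun i => π i (M.toChild s.1 i) (s.2 i).1 (s.2 i).2,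
    (fun i => (M.toChild s.1 i, (s.2 i).1), M.toLeaves s.1))
  invFun t := (M.wiring.symm (fun i => (t.2.1 i).1, t.2.2),
    fun i => ((t.2.1 i).2, (π i (t.2.1 i).1 (t.2.1 i).2).symm (t.1 i)))
  left_inv s := by
    obtain ⟨x, l⟩ := s
    refine Prod.ext (M.wiring.symm_apply_apply x) ?_
    funext i
    simp
  right_inv t := by
    obtain ⟨y, z, w⟩ := t
    have h := M.wiring.apply_symm_apply (fun i => (z i).1, w)
    have h1 : M.toChild (M.wiring.symm (fun i => (z i).1, w)) = fun i => (z i).1 :=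
      congrArg Prod.fst h
    have h2 : M.toLeaves (M.wiring.symm (fun i => (z i).1, w)) = w := congrArg Prod.snd h
    simp only [h1, h2]
    exact Prod.ext (funext fun i => Equiv.apply_symm_apply _ _) rfl

/-- The sink records everything but the ancillas. -/
theorem globalPerm_apply_snd_eq_iff (s s' : SourceIdx M.copyNode (M.exoNode K)) :
    (M.globalPerm π s).2 = (M.globalPerm π s').2 ↔
      s.1 = s'.1 ∧ ∀ i, (s.2 i).1 = (s'.2 i).1 := by
  constructor
  · intro h
    have h1 := congrArg Prod.fst h
    refine ⟨M.wiring.injective (Prod.ext ?_ (congrArg Prod.snd h :)), fun i => ?_⟩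
    · funext i
      exact congrArg Prod.fst (congrFun h1 i)
    · exact congrArg Prod.snd (congrFun h1 i)
  · rintro ⟨h1, h2⟩
    simp only [globalPerm, Equiv.coe_fn_mk, h1, h2]
    rfl

theorem process_factorisation :
    choi (conjMap (permMatrix (M.globalPerm π))) =
      (tensorPi (fun i => choi (conjMap (permMatrix (M.localPerm π i)))) ⊗ₖ
        choi (LinearMap.id (R := ℂ) (M := Matrix M.leafSystem.idx M.leafSystem.idx ℂ))).submatrix
        (M.regroup (M.exoNode K) (M.localSink K)) (M.regroup (M.exoNode K) (M.localSink K)) := by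
  have key : ∀ (t : TargetIdx M.copyNode (M.sinkSystem (M.localSink K)))
      (s : SourceIdx M.copyNode (M.exoNode K)), t = M.globalPerm π s ↔
        (∀ i, (t.1 i, t.2.1 i) = M.localPerm π i (M.toChild s.1 i, s.2 i)) ∧
          t.2.2 = M.toLeaves s.1 := by
    intro t s
    constructor
    · rintro rfl
      exact ⟨fun i => rfl, rfl⟩
    · rintro ⟨h1, h2⟩
      refine Prod.ext (funext fun i => congrArg Prod.fst (h1 i))
        (Prod.ext (funext fun i => congrArg Prod.snd (h1 i)) h2)
  ext ⟨t, s⟩ ⟨t', s'⟩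
  have hid : ∀ p q : M.leafSystem.idx × M.leafSystem.idx,
      choi (LinearMap.id (R := ℂ) (M := Matrix M.leafSystem.idx M.leafSystem.idx ℂ)) p q =
        if p.1 = p.2 ∧ q.1 = q.2 then 1 else 0 := by
    intro p q
    simp [choi_apply, Matrix.single_apply, eq_comm]
  simp only [Matrix.submatrix_apply, Matrix.kroneckerMap_apply, tensorPi, Matrix.of_apply, hid,
    choi_permMatrix_apply, Finset.prod_ite_zero, Finset.prod_const_one, Finset.mem_univ,
    true_imp_iff, ite_zero_mul_ite_zero, mul_one]
  refine if_congr ?_ rfl rfl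
  rw [key, key, forall_and]
  exact and_and_and_comm

/-- `Λ_j` influences only node `j`: the controlled permutation at node `i` sees the exogenous node
`Λ_i` and no other. -/
theorem noInfluence_globalPerm {i j : Fin n} (hij : j ≠ i) :
    NoInfluence (splitSource M.copyNode (M.exoNode K) j)
      (splitTarget M.copyNode (M.sinkSystem (M.localSink K)) i)
      (permMatrix (M.globalPerm π)) := by
  classical
  let i' : {k // k ≠ j} := ⟨i, hij.symm⟩
  let Y : Fin n → Type := fun k => (M.copyNode k).inn.idx
  -- Apply `π i` to the ancilla of `Λ_i`, and set it apart from everything else.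
  let τ : (∀ k, (M.copyNode k).out.idx) × (∀ k : {k // k ≠ j}, (M.exoNode K k.1).out.idx) ≃
      ((∀ k, (M.copyNode k).out.idx) × K i ×
        (∀ k : {k : {k // k ≠ j} // k ≠ i'}, (M.exoNode K k.1.1).out.idx)) × Y i :=
    (Equiv.prodCongr (Equiv.refl _)
      (Equiv.piSplitAt i' fun k : {k // k ≠ j} => (M.exoNode K k.1).out.idx)).trans
    { toFun := fun x => ((x.1, x.2.1.1, x.2.2), π i (M.toChild x.1 i) x.2.1.1 x.2.1.2)
      invFun := fun y => (y.1.1, ((y.1.2.1,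
        (π i (M.toChild y.1.1 i) y.1.2.1).symm y.2), y.1.2.2))
      left_inv := fun x => by
        obtain ⟨x, ⟨k, y⟩, r⟩ := x
        simp
      right_inv := fun x => by
        obtain ⟨⟨x, k, r⟩, y⟩ := x
        exact Prod.ext rfl (Equiv.apply_symm_apply _ _) }
  have hsrc : ∀ x y, ((splitSource M.copyNode (M.exoNode K) j).symm (x, y)).1 = y.1 :=
    fun x y => rfl
  have hsrc_self : ∀ x y, ((splitSource M.copyNode (M.exoNode K) j).symm (x, y)).2 j = x :=
    fun x y => by simp [splitSource]
  have hsrc_ne : ∀ x y (k) (hk : k ≠ j),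
      ((splitSource M.copyNode (M.exoNode K) j).symm (x, y)).2 k = y.2 ⟨k, hk⟩ :=
    fun x y k hk => by simp [splitSource, hk]
  refine noInfluence_permMatrix _ _ _ τ (fun x y => ?_) (fun x y x' y' => ?_)
  · change π i (M.toChild _ i) (Prod.fst _) (Prod.snd _) =
      π i (M.toChild y.1 i) (y.2 i').1 (y.2 i').2
    rw [hsrc, hsrc_ne x y i hij.symm]
  · set s := (splitSource M.copyNode (M.exoNode K) j).symm (x, y) with hs
    set s' := (splitSource M.copyNode (M.exoNode K) j).symm (x', y') with hs'
    have hτ : (τ y).1 = (τ y').1 ↔ y.1 = y'.1 ∧ (y.2 i').1 = (y'.2 i').1 ∧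
        ∀ k : {k // k ≠ j}, k ≠ i' → y.2 k = y'.2 k := by
      rw [Prod.ext_iff, Prod.ext_iff, funext_iff (f := ((τ y).1.2.2))]
      exact and_congr Iff.rfl (and_congr Iff.rfl Subtype.forall)
    have hσ : (splitTarget M.copyNode (M.sinkSystem (M.localSink K)) i (M.globalPerm π s)).1 =
        (splitTarget M.copyNode (M.sinkSystem (M.localSink K)) i (M.globalPerm π s')).1 ↔
        (∀ k, k ≠ i → (M.globalPerm π s).1 k = (M.globalPerm π s').1 k) ∧
          s.1 = s'.1 ∧ ∀ k, (s.2 k).1 = (s'.2 k).1 := by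
      rw [← M.globalPerm_apply_snd_eq_iff π, Prod.ext_iff, funext_iff]
      exact and_congr Subtype.forall Iff.rfl
    rw [hτ, hσ]
    constructor
    · rintro ⟨h1, h2, h3⟩
      have h4 : ∀ k, k ≠ i → s.2 k = s'.2 k := by
        intro k hk
        refine Prod.ext (h3 k) ((π k (M.toChild s'.1 k) (s'.2 k).1).injective ?_)
        have := h1 k hk
        simp only [globalPerm, Equiv.coe_fn_mk, h2, h3] at this
        exact this
      refine ⟨?_, h2, ?_, fun k hk => ?_⟩
      · rw [← hsrc_self x y, ← hsrc_self x' y']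
        exact h4 j hij
      · rw [← hsrc_ne x y i hij.symm, ← hsrc_ne x' y' i hij.symm]
        exact h3 i
      · rw [← hsrc_ne x y k k.2, ← hsrc_ne x' y' k k.2]
        exact h4 k fun h => hk (Subtype.ext h)
    · rintro ⟨h1, h2, h3, h4⟩
      have h5 : ∀ k, k ≠ i → s.2 k = s'.2 k := by
        intro k hk
        by_cases hkj : k = j
        · subst hkj
          rw [hs, hs', hsrc_self, hsrc_self, h1]
        · rw [hs, hs', hsrc_ne _ _ k hkj, hsrc_ne _ _ k hkj]
          exact h4 ⟨k, hkj⟩ fun h => hk (congrArg Subtype.val h)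
      refine ⟨fun k hk => ?_, h2, fun k => ?_⟩
      · change π k (M.toChild s.1 k) (s.2 k).1 (s.2 k).2 =
          π k (M.toChild s'.1 k) (s'.2 k).1 (s'.2 k).2
        rw [h5 k hk, show s.1 = s'.1 from h2]
      · by_cases hk : k = i
        · subst hk
          rw [hs, hs', hsrc_ne _ _ k hij.symm, hsrc_ne _ _ k hij.symm]
          exact h3
        · rw [h5 k hk]

/-! ### Probabilities of the process -/

/-- The operator `tr_{S_i}[W_i (|a⟩⟨a| ⊗ ρ) W_i†]` that arrives at node `i` if its parents send the
basis vector `|a⟩` and the exogenous node sends `ρ`. -/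
def arriving (i : Fin n) (a : (M.parentSystem i).idx)
    (ρ : Matrix (M.exoNode K i).out.idx (M.exoNode K i).out.idx ℂ) :
    Matrix (M.copySystem i).idx (M.copySystem i).idx ℂ :=
  ∑ l, ∑ l', (if l.1 = l'.1 then ρ l l' else 0) •
    Matrix.single (π i a l.1 l.2) (π i a l'.1 l'.2) 1

theorem trace_arriving (i : Fin n) (a : (M.parentSystem i).idx)
    (ρ : Matrix (M.exoNode K i).out.idx (M.exoNode K i).out.idx ℂ) :
    (M.arriving π i a ρ).trace = ρ.trace := by
  simp only [arriving, Matrix.trace_sum, Matrix.trace_smul]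
  refine Finset.sum_congr rfl fun l _ => ?_
  rw [Finset.sum_eq_single l]
  · simp
  · intro l' _ hl'
    by_cases h : l.1 = l'.1
    · rw [Matrix.trace_single_eq_of_ne, smul_zero]
      intro h'
      rw [h] at h'
      exact hl' (Prod.ext h.symm ((π i a l'.1).injective h'.symm))
    · simp [h]
  · simp

theorem map_arriving_apply (i : Fin n) (a : (M.parentSystem i).idx)
    (ρ : Matrix (M.exoNode K i).out.idx (M.exoNode K i).out.idx ℂ)
    (T : Matrix (M.copySystem i).idx (M.copySystem i).idx ℂ →ₗ[ℂ]
      Matrix (M.copySystem i).idx (M.copySystem i).idx ℂ) (x y : (M.copySystem i).idx) :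
    T (M.arriving π i a ρ) x y = ∑ l, ∑ l', (if l.1 = l'.1 then ρ l l' else 0) *
      T (Matrix.single (π i a l.1 l.2) (π i a l'.1 l'.2) 1) x y := by
  simp only [arriving, map_sum, map_smul, Matrix.sum_apply, Matrix.smul_apply, smul_eq_mul]

/-- The Born rule for the process in causal form. The sink holds the outgoing labels of all nodes, so
these are decohered, and the total probability is a sum over classical labels `x` of products of
kernels, the one at `i` depending on `x i` and the labels of the parents of `i` only. -/
theorem born_globalPerm
    (T : ∀ i, Matrix (M.copySystem i).idx (M.copySystem i).idx ℂ →ₗ[ℂ]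
      Matrix (M.copySystem i).idx (M.copySystem i).idx ℂ)
    (p : Fin n → ℝ)
    (ρ : ∀ i, Matrix (M.exoNode K i).out.idx (M.exoNode K i).out.idx ℂ) :
    born (A := M.copyNode) (Λ := M.exoNode K) (S := M.sinkSystem (M.localSink K))
      (choi (conjMap (permMatrix (M.globalPerm π)))) (fun i => choiNode (T i))
      (fun i => preparation (M.exoNode K i) (p i) (ρ i)) =
    ∑ x : ∀ i, (M.copySystem i).idx,
      ∏ i, (p i * T i (M.arriving π i (M.toChild x i) (ρ i)) (x i) (x i)) := by
  rw [born_permMatrix, Fintype.sum_prod_type]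
  refine Finset.sum_congr rfl fun x _ => ?_
  let g : ∀ i, (M.exoNode K i).out.idx → (M.exoNode K i).out.idx → ℂ := fun i l l' =>
    if l.1 = l'.1 then T i (Matrix.single (π i (M.toChild x i) l.1 l.2)
      (π i (M.toChild x i) l'.1 l'.2) 1) (x i) (x i) * (p i * ρ i l l') else 0
  have hg : ∀ i, p i * T i (M.arriving π i (M.toChild x i) (ρ i)) (x i) (x i) =
      ∑ l, ∑ l', g i l l' := by
    intro i
    refine (congrArg (fun z : ℂ => p i * z) (M.map_arriving_apply π i _ _ (T i) _ _)).trans ?_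
    simp only [Finset.mul_sum, g]
    refine Finset.sum_congr rfl fun l _ => Finset.sum_congr rfl fun l' _ => ?_
    split_ifs
    · ring
    · simp
  have hprod : ∀ f : ∀ i, (M.exoNode K i).out.idx → ℂ,
      ∏ i, ∑ l, f i l = ∑ l : ∀ i, (M.exoNode K i).out.idx, ∏ i, f i (l i) := by
    intro f
    rw [Finset.prod_univ_sum, Fintype.piFinset_univ]
  rw [Finset.prod_congr rfl fun i _ => hg i, hprod]
  refine Finset.sum_congr rfl fun l _ => ?_
  rw [hprod, Fintype.sum_prod_type, Finset.sum_eq_single x]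
  · refine Finset.sum_congr rfl fun l' _ => ?_
    simp only [globalPerm_apply_snd_eq_iff, true_and, g, Finset.prod_ite_zero, Finset.mem_univ,
      true_imp_iff]
    refine if_congr Iff.rfl (Finset.prod_congr rfl fun i _ => ?_) rfl
    exact congrArg (· * (p i * ρ i (l i) (l' i) : ℂ)) (choiNode_apply (T i) _ _)
  · intro x' _ hx'
    refine Finset.sum_eq_zero fun l' _ => ?_
    rw [if_neg]
    rw [globalPerm_apply_snd_eq_iff]
    exact fun h => hx' h.1.symm
  · simp

/-- Ancestry is well-founded upwards as well, since the graph is finite: every non-empty set of nodes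
has an element without children in the set. -/
theorem wellFounded_flip_pa : WellFounded (flip fun j i => j ∈ M.pa i) := by
  have : Std.Irrefl (Relation.TransGen (flip fun j i => j ∈ M.pa i)) :=
    ⟨fun i h => M.acyclic i (Relation.transGen_swap.1 h)⟩
  exact Subrelation.wf (fun h => Relation.TransGen.single h)
    (Finite.wellFounded_of_trans_of_irrefl
      (Relation.TransGen (flip fun j i => j ∈ M.pa i)))

theorem isNormalised_globalPerm :
    IsNormalised (A := M.copyNode) (Λ := M.exoNode K) (S := M.sinkSystem (M.localSink K))
      (permMatrix (M.globalPerm π)) := by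
  intro T ρ hT hρ
  refine (M.born_globalPerm π T (fun _ => 1) ρ).trans ?_
  have h := sum_prod_causal_kernels (R := fun j i => j ∈ M.pa i) M.wellFounded_flip_pa
    (X := fun i => (M.copySystem i).idx)
    (fun i x a => T i (M.arriving π i (M.toChild x i) (ρ i)) a a) (fun _ => 1) ?_ ?_
  · rw [Finset.prod_const_one] at h
    refine Eq.trans ?_ h
    refine Finset.sum_congr rfl fun x _ => Finset.prod_congr rfl fun i _ => ?_
    exact (congrArg (· * _) Complex.ofReal_one).trans (one_mul _)
  · intro i x x' hx
    have : M.toChild x i = M.toChild x' i := by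
      funext j
      simp only [toChild, hx j.1 j.2]
    simp only [this]
  · intro i x
    exact ((hT i).2 _).trans ((M.trace_arriving π i _ _).trans (hρ i).2)

theorem solution_eq_of_forall {u : ∀ i, M.U i} {v : ∀ i, M.V i}
    (h : ∀ i, v i = M.f i (fun j => v j.1) (u i)) : M.solution u = v := by
  funext i
  induction i using M.wellFounded_pa.induction with
  | h i ih =>
    rw [solution_eq, h i]
    congr 1
    funext j
    exact ih j.1 j.2

/-- The label of the basis vector `|b⟩ ⊗ ⋯ ⊗ |b⟩`. -/
def copies (i : Fin n) (b : M.Bits i) : (M.copySystem i).idx := fun _ => b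

/-- Holds because every node has at least one copy. -/
theorem copies_injective (i : Fin n) : Function.Injective (M.copies i) := by
  have : Nonempty (M.CopyIdx i) := by
    by_cases h : ∀ j, i ∉ M.pa j
    · exact ⟨Sum.inr ⟨(), h⟩⟩
    · push Not at h
      obtain ⟨j, hj⟩ := h
      exact ⟨Sum.inl ⟨j, hj⟩⟩
  exact Function.const_injective

/-- If the exogenous nodes send the basis vectors `|k i⟩ ⊗ |y₀ i⟩`, the outcome `v` is certain (up to
the factors `p i`) when every `π i` sends `y₀ i` to the copies of `v i`, and impossible otherwise. -/
theorem born_measure (e : ∀ i, M.V i ↪ M.Bits i) (v : ∀ i, M.V i) (p : Fin n → ℝ)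
    (k : ∀ i, K i) (y₀ : ∀ i, (M.copySystem i).idx) :
    born (A := M.copyNode) (Λ := M.exoNode K) (S := M.sinkSystem (M.localSink K))
      (choi (conjMap (permMatrix (M.globalPerm π)))) (fun i => M.copyMeasurement i (e i) (v i))
      (fun i => preparation (M.exoNode K i) (p i) (Matrix.single (k i, y₀ i) (k i, y₀ i) 1)) =
    ∏ i, (if π i (fun j => e j.1 (v j.1)) (k i) (y₀ i) = M.copies i (e i (v i)) then 1 else 0) *
      (p i : ℂ) := by
  let w : ∀ i, (M.copySystem i).idx := fun i => M.copies i (e i (v i))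
  have harr : ∀ i a, M.arriving π i a (Matrix.single (k i, y₀ i) (k i, y₀ i) 1) =
      Matrix.single (π i a (k i) (y₀ i)) (π i a (k i) (y₀ i)) 1 := by
    intro i a
    rw [arriving, Finset.sum_eq_single (k i, y₀ i), Finset.sum_eq_single (k i, y₀ i)]
    · simp
    · intro l' _ hl'
      simp [Ne.symm hl']
    · simp
    · intro l _ hl
      refine Finset.sum_eq_zero fun l' _ => ?_
      simp [Ne.symm hl]
    · simp
  have hm : ∀ i (X : Matrix (M.copySystem i).idx (M.copySystem i).idx ℂ) x,
      measureMap (w i) X x x = if x = w i then X (w i) (w i) else 0 := by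
    intro i X x
    change (Matrix.single (w i) (w i) (1 : ℂ) * X *
      (Matrix.single (w i) (w i) (1 : ℂ)).conjTranspose) x x = _
    by_cases hx : x = w i
    · subst hx
      simp
    · simp [hx]
  refine (M.born_globalPerm π (fun i => measureMap (w i)) p _).trans ?_
  rw [Finset.sum_eq_single w]
  · refine Finset.prod_congr rfl fun i _ => ?_
    rw [hm, harr, if_pos rfl, Matrix.single_apply, mul_comm]
    exact congrArg (· * (p i : ℂ)) (if_congr (and_self_iff) rfl rfl)
  · intro x _ hx
    obtain ⟨i, hi⟩ := Function.ne_iff.1 hx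
    refine Finset.prod_eq_zero (Finset.mem_univ i) ?_
    rw [hm, if_neg hi, mul_zero]
  · simp

end CSM

/-! ### Probabilistic structural causal models -/

namespace PSM

variable {n : ℕ} (M : PSM.{u, v} n)

theorem marginal_nonneg (i : Fin n) (a : M.U i) : 0 ≤ M.marginal i a :=
  Finset.sum_nonneg fun u _ => by split_ifs <;> simp [M.P_nonneg]

theorem sum_marginal (i : Fin n) : ∑ a, M.marginal i a = 1 := by
  classical
  simp only [marginal]
  rw [Finset.sum_comm]
  simp [M.P_sum]

theorem nonempty_U (i : Fin n) : Nonempty (M.U i) := by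
  by_contra h
  rw [not_nonempty_iff] at h
  simpa using M.sum_marginal i

theorem nonempty_V (i : Fin n) : Nonempty (M.V i) :=
  ⟨M.solution (fun i => (M.nonempty_U i).some) i⟩

theorem endoProb_eq_sum_markovTerm (hM : M.Independent) (v : ∀ i, M.V i) :
    M.endoProb v = ∑ u, M.markovTerm v u := by
  classical
  refine Finset.sum_congr rfl fun u _ => ?_
  rw [markovTerm, Finset.prod_mul_distrib, ← hM u]
  have : M.solution u = v ↔ ∀ i, v i = M.f i (fun j => v j.1) (u i) := by
    constructor
    · rintro rfl i
      exact M.solution_eq u i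
    · exact M.solution_eq_of_forall
  simp [Finset.prod_ite_zero, this]

end PSM

end

/-! ### The quantum extension -/

theorem mainTheorem1 {n : ℕ} (M : PSM.{u, v} n) (hM : M.Independent) :
    ∃ (e : ∀ i, M.V i ↪ M.Bits i) (Λ : Fin n → QNode) (S : Fin n → QSystem)
      (Q : QSM M.copyNode Λ (M.sinkSystem S) M.U),
      -- the outcomes `u_i` of the exogenous instruments have probability `P(u_i)`
      (∀ i a, Q.prob i a = M.marginal i a) ∧
      -- the joint distribution of exogenous and endogenous values is reproduced
      (∀ (v : ∀ i, M.V i) (u : ∀ i, M.U i),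
        born Q.process (fun i => M.copyMeasurement i (e i) (v i)) (fun i => Q.instrument i (u i))
          = (M.markovTerm v u : ℂ)) ∧
      -- the distribution `P(v)`
      (∀ v : ∀ i, M.V i,
        M.endoProb v = ∑ u, M.markovTerm v u ∧
        (M.endoProb v : ℂ) = ∑ u : ∀ i, M.U i,
          born Q.process (fun i => M.copyMeasurement i (e i) (v i))
            (fun i => Q.instrument i (u i))) ∧
      -- the process factorises node by node along the causal graph
      ∃ W : ∀ i, Matrix ((M.copyNode i).inn.idx × (S i).idx)
          ((M.parentSystem i).idx × (Λ i).out.idx) ℂ,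
        (∀ i, IsUnitaryMap (W i)) ∧
        Q.process =
          (tensorPi (fun i => choi (conjMap (W i))) ⊗ₖ
            choi (LinearMap.id (R := ℂ) (M := Matrix M.leafSystem.idx M.leafSystem.idx ℂ))).submatrix
            (M.regroup Λ S) (M.regroup Λ S) := by
  classical
  have hU := M.nonempty_U
  have hV := M.nonempty_V
  have he : ∀ i, Nonempty (M.V i ↪ M.Bits i) := fun i => by
    refine Function.Embedding.nonempty_of_card_le ?_
    rw [Fintype.card_fun, Fintype.card_bool, Fintype.card_fin]
    exact Nat.le_pow_clog one_lt_two _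
  let e : ∀ i, M.V i ↪ M.Bits i := fun i => (he i).some
  -- The labels `u_i` are enumerated, since a `QSystem` has its basis in `Type`.
  let K : Fin n → Type := fun i => Fin (Fintype.card (M.U i))
  let c : ∀ i, M.U i ≃ K i := fun i => Fintype.equivFin (M.U i)
  have : ∀ i, Nonempty (K i) := fun i => (hU i).map (c i)
  let y₀ : ∀ i, (M.copySystem i).idx := fun i _ _ => false
  -- The structural functions on bit strings; strings that encode no value are decoded arbitrarily.
  let F : ∀ i, (M.parentSystem i).idx → K i → M.V i := fun i a k =>
    M.f i (fun j => Function.invFun (e j.1) (a j)) ((c i).symm k)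
  -- Only the image of `y₀` matters: any permutation taking `y₀` to the copies of the value of `f_i`
  -- would serve. The transposition is the simplest.
  let π : ∀ i, (M.parentSystem i).idx → K i → Equiv.Perm (M.copySystem i).idx := fun i a k =>
    Equiv.swap (y₀ i) (M.copies i (e i (F i a k)))
  let Q : QSM M.copyNode (M.exoNode K) (M.sinkSystem (M.localSink K)) M.U :=
    { U := permMatrix (M.globalPerm π)
      unitary := isUnitaryMap_permMatrix _
      normalised := M.isNormalised_globalPerm π
      noInfluence := fun i j hij => M.noInfluence_globalPerm π hij
      prob := M.marginal
      prob_nonneg := M.marginal_nonneg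
      prob_sum := M.sum_marginal
      state := fun i a => Matrix.single (c i a, y₀ i) (c i a, y₀ i) 1
      state_density := fun i a => ⟨by
        rw [← Matrix.diagonal_single]
        exact Matrix.PosSemidef.diagonal (Pi.single_nonneg.2 zero_le_one), by simp⟩ }
  have hborn : ∀ (v : ∀ i, M.V i) (u : ∀ i, M.U i),
      born Q.process (fun i => M.copyMeasurement i (e i) (v i)) (fun i => Q.instrument i (u i))
        = (M.markovTerm v u : ℂ) := by
    intro v u
    refine (M.born_measure π e v (fun i => M.marginal i (u i)) (fun i => c i (u i)) y₀).trans ?_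
    rw [PSM.markovTerm, Complex.ofReal_prod]
    refine Finset.prod_congr rfl fun i _ => ?_
    rw [Complex.ofReal_mul]
    congr 1
    have hF : F i (fun j => e j.1 (v j.1)) (c i (u i)) = M.f i (fun j => v j.1) (u i) := by
      simp only [F, Equiv.symm_apply_apply, Function.leftInverse_invFun (e _).injective _]
    have hiff : π i (fun j => e j.1 (v j.1)) (c i (u i)) (y₀ i) = M.copies i (e i (v i)) ↔
        v i = M.f i (fun j => v j.1) (u i) := by
      rw [← hF, ← (e i).injective.eq_iff, ← (M.copies_injective i).eq_iff, eq_comm]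
      exact iff_of_eq (congrArg _ (Equiv.swap_apply_left _ _))
    by_cases h : v i = M.f i (fun j => v j.1) (u i)
    · rw [if_pos h, if_pos (hiff.2 h), Complex.ofReal_one]
    · rw [if_neg h, if_neg (mt hiff.1 h), Complex.ofReal_zero]
  refine ⟨e, M.exoNode K, M.localSink K, Q, fun _ _ => rfl, hborn, fun v => ⟨?_, ?_⟩,
    fun i => permMatrix (M.localPerm π i), fun i => isUnitaryMap_permMatrix _,
    M.process_factorisation π⟩
  · exact M.endoProb_eq_sum_markovTerm hM v
  · rw [M.endoProb_eq_sum_markovTerm hM v, Complex.ofReal_sum]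
    exact Finset.sum_congr rfl fun u _ => (hborn v u).symm
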